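/- Let $\mathcal U$ be a non-principal ultrafilter on $\omega$. Let $\mathbb L_{\mathcal U}$ be the forcing notion consisting of all trees $T\subseteq\omega^{<\omega}$ (nonempty sets of finite sequences closed under initial segments) that have a finite stem $\mathrm{stem}(T)$ (the longest element of $T$ that is comparable with every element of $T$), and such that $\{n\in\omega : s^\frown n\in T\}\in\mathcal U$ for every $s\in T$ with $s\supseteq\mathrm{stem}(T)$; a condition $T'$ is stronger than $T$ if $T'\subseteq T$. Then the following are equivalent: (1) $\mathbb L_{\mathcal U}$ has the Laver property: whenever $\dot f$ is an $\mathbb L_{\mathcal U}$-name for an element of $\omega^\omega$ and $g\in\omega^\omega$ is a ground model function such that $\Vdash \dot f(n)<g(n)$ for all $n\in\omega$, then it is forced that there is some $S\in\prod_{n\in\omega}[g(n)]^{\le n+1}$ in the ground model with $\dot f(n)\in S(n)$ for every $n\in\omega$. (Here $[g(n)]^{\le n+1}$ denotes the set of subsets of $g(n)=\{0,\dots,g(n)-1\}$ with at most $n+1$ elements.) (2) $\mathcal U$ is a Laver ultrafilter: for every sequence $\langle\mathcal P_n : n\in\omega\rangle$ of partitions of $\omega$ into finitely many sets, there is $x\in\mathcal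 U$ such that for every $n\in\omega$, $x$ has non-empty intersection with at most $n+1$ elements of $\mathcal P_n$. -/

import Mathlib

universe u

/-! ## Names and the forcing relation over a forcing notion `P` (smaller conditions are stronger) -/

/-- `P`-names: a name is a (small) family of pairs `(name, condition)`. -/
inductive PName (P : Type u) : Type (u + 1)
  | mk (ι : Type u) (name : ι → PName P) (cond : ι → P) : PName P

namespace PName

variable {P : Type u} [Preorder P]

/-- `ForcesEq a b p` is `p ⊩ a = b`: below `p`, every element of `a` is forced to be an element of
`b`, and conversely. -/
def ForcesEq : PName P → PName P → P → Prop
  | mk ι x c, mk κ y d => fun p =>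
    (∀ i : ι, ∀ q ≤ p, q ≤ c i → ∃ r ≤ q, ∃ j : κ, r ≤ d j ∧ ForcesEq (x i) (y j) r) ∧
    (∀ j : κ, ∀ q ≤ p, q ≤ d j → ∃ r ≤ q, ∃ i : ι, r ≤ c i ∧ ForcesEq (x i) (y j) r)

/-- `ForcesMem a b p` is `p ⊩ a ∈ b`: the conditions `r` for which there is `(y, d) ∈ b` with
`r ≤ d` and `r ⊩ a = y` are dense below `p`. -/
def ForcesMem (a : PName P) : PName P → P → Prop
  | mk κ y d => fun p => ∀ q ≤ p, ∃ r ≤ q, ∃ j : κ, r ≤ d j ∧ ForcesEq a (y j) r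

/-- The canonical name `x̌` of a ground model set `x`. -/
def check [OrderTop P] : PSet.{u} → PName P
  | PSet.mk ι x => mk ι (fun i => check (x i)) (fun _ => ⊤)

end PName

/-! A statement of the forcing language is represented by the set of conditions that force it.
The connectives are given by the usual recursive clauses of the forcing relation. -/

namespace Forcing

variable {P : Type u} [Preorder P]

/-- `p ⊩ ¬φ`. -/
def Neg (φ : P → Prop) : P → Prop := fun p => ∀ q ≤ p, ¬ φ q

/-- `p ⊩ φ ∧ ψ`. -/
def Conj (φ ψ : P → Prop) : P → Prop := fun p => φ p ∧ ψ p

/-- `p ⊩ φ → ψ`. -/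
def Impl (φ ψ : P → Prop) : P → Prop := Neg (Conj φ (Neg ψ))

/-- `p ⊩ ∀ i, φ i`. -/
def All {ι : Type*} (φ : ι → P → Prop) : P → Prop := fun p => ∀ i, φ i p

/-- `p ⊩ ∃ i, φ i`: the conditions forcing some instance are dense below `p`. -/
def Ex {ι : Type*} (φ : ι → P → Prop) : P → Prop := fun p => ∀ q ≤ p, ∃ r ≤ q, ∃ i, φ i r

/-- `⊩ φ`: every condition forces `φ`. -/
def Forced (φ : P → Prop) : Prop := ∀ p, φ p

/-- The Kuratowski pair `(n, m)` of two natural numbers, as a set. -/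
def natPair (n m : ℕ) : PSet.{u} :=
  {{PSet.ofNat n}, {PSet.ofNat n, PSet.ofNat m}}

/-- The set `ω × ω`. -/
def natProd : PSet.{u} :=
  PSet.mk (ULift.{u} (ℕ × ℕ)) (fun z => natPair z.down.1 z.down.2)

variable [OrderTop P]

/-- The statement `f(n) = m`, that is, `(n, m)ˇ ∈ f`. -/
def Value (f : PName P) (n m : ℕ) : P → Prop :=
  PName.ForcesMem (PName.check (natPair n m)) f

/-- The statement `f ∈ ω^ω`: `f ⊆ ω × ω`, and `f` is total and single-valued. (A quantifier over the
elements of a ground model set ranges over their canonical names.) -/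
def IsReal (f : PName P) : P → Prop :=
  Conj (All fun x : PName P =>
      Impl (PName.ForcesMem x f) (PName.ForcesMem x (PName.check natProd)))
    (Conj (All fun n : ℕ => Ex fun m : ℕ => Value f n m)
      (All fun n : ℕ => All fun z : {z : ℕ × ℕ // z.1 ≠ z.2} =>
        Neg (Conj (Value f n z.1.1) (Value f n z.1.2))))

/-- The statement `f(n) < g(n)` for all `n ∈ ω`, where `g ∈ ω^ω` is in the ground model. -/
def BoundedBy (f : PName P) (g : ℕ → ℕ) : P → Prop :=
  All fun n : ℕ => Ex fun m : {m : ℕ // m < g n} => Value f n m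

/-- The elements of `∏ n, [g(n)]^{≤ n+1}` in the ground model. -/
def Slalom (g : ℕ → ℕ) : Type :=
  {S : ℕ → Finset ℕ // ∀ n, S n ⊆ Finset.range (g n) ∧ (S n).card ≤ n + 1}

/-- The Laver property of the forcing notion `P`. -/
def LaverProperty (P : Type u) [Preorder P] [OrderTop P] : Prop :=
  ∀ (f : PName P) (g : ℕ → ℕ), Forced (IsReal f) → Forced (BoundedBy f g) →
    Forced (Ex fun S : Slalom g => All fun n : ℕ => Ex fun m : {m : ℕ // m ∈ S.1 n} =>
      Value f n m)

end Forcing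

/-! ## Laver forcing relative to an ultrafilter -/

/-- A tree on `ω`: a nonempty set of finite sequences closed under initial segments. -/
def IsSeqTree (T : Set (List ℕ)) : Prop :=
  T.Nonempty ∧ ∀ s t : List ℕ, s <+: t → t ∈ T → s ∈ T

/-- `s` is the stem of `T`: the longest element of `T` compatible with all elements of `T`. -/
def IsStem (T : Set (List ℕ)) (s : List ℕ) : Prop :=
  (s ∈ T ∧ ∀ t ∈ T, s <+: t ∨ t <+: s) ∧
    ∀ s' ∈ T, (∀ t ∈ T, s' <+: t ∨ t <+: s') → s'.length ≤ s.length

/-- The set of immediate successors of `s` in `T`. -/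
def succSet (T : Set (List ℕ)) (s : List ℕ) : Set ℕ := {n | s ++ [n] ∈ T}

/-- Conditions of Laver forcing relative to `U`: trees which have a (finite) stem, and in which all
nodes extending the stem have a set of successors that belongs to `U`. -/
def IsLaverTree (U : Ultrafilter ℕ) (T : Set (List ℕ)) : Prop :=
  IsSeqTree T ∧ ∃ s, IsStem T s ∧ ∀ t ∈ T, s <+: t → succSet T t ∈ U

/-- Laver forcing `𝕃_U` relative to `U`. -/
def LaverForcing (U : Ultrafilter ℕ) : Type := {T : Set (List ℕ) // IsLaverTree U T}

/-- A tree is a stronger condition than the trees which contain it. -/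
instance LaverForcing.instPartialOrder (U : Ultrafilter ℕ) : PartialOrder (LaverForcing U) where
  le T S := T.1 ⊆ S.1
  le_refl _ := subset_rfl
  le_trans _ _ _ h₁ h₂ := h₁.trans h₂
  le_antisymm _ _ h₁ h₂ := Subtype.ext (Set.Subset.antisymm h₁ h₂)

theorem isLaverTree_univ (U : Ultrafilter ℕ) : IsLaverTree U Set.univ := by
  refine ⟨⟨⟨[], trivial⟩, fun _ _ _ _ => trivial⟩, [],
    ⟨⟨trivial, fun t _ => Or.inl t.nil_prefix⟩, ?_⟩, ?_⟩
  · intro s' _ h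
    rcases s' with _ | ⟨a, l⟩
    · exact le_rfl
    · rcases h [a + 1] trivial with h | h
      · simp [List.cons_prefix_cons] at h
      · simp [List.cons_prefix_cons] at h
  · intro t _ _
    have : succSet Set.univ t = Set.univ := Set.eq_univ_of_forall fun _ => trivial
    rw [this]
    exact Filter.univ_mem

/-- The weakest condition is the tree of all finite sequences. -/
instance LaverForcing.instOrderTop (U : Ultrafilter ℕ) : OrderTop (LaverForcing U) where
  top := ⟨Set.univ, isLaverTree_univ U⟩
  le_top T := Set.subset_univ T.1

/-! ## Laver ultrafilters -/

/-- `U` is a Laver ultrafilter: for every sequence of finite partitions `Q n` of `ω` there is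
`x ∈ U` that meets at most `n + 1` elements of each `Q n`. -/
def IsLaverUltrafilter (U : Ultrafilter ℕ) : Prop :=
  ∀ Q : ℕ → Finpartition (Set.univ : Set ℕ), ∃ x ∈ U, ∀ n,
    {A : Set ℕ | A ∈ (Q n).parts ∧ (x ∩ A).Nonempty}.ncard ≤ n + 1

/-!
Throughout, `U` is nonprincipal, so that a Laver tree is a tree with a stem in the sense of
`HasStem`, and stems grow along extensions of conditions.

*A Laver ultrafilter gives the Laver property.* Two conditions with the same stem are compatible,
and `U`-many conditions whose stems are the successors `t ++ [a]` of `t` amalgamate to a condition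
with stem `t` (`PurelyForces.of_succ`). Since `U` decides between finitely many alternatives, this
gives pure decision (`exists_purelyForces`): if `f` is a name for a real bounded by `g`, then below
a condition `T` every node `t` beyond the stem has a unique `v t n < g n` such that some condition
with stem `t` forces `f(n) = v t n`, and `v t n` is the `U`-limit of `v (t ++ [a]) n`.
A condition `T' ≤ T` with the same stem then forces `f(n)` to be among the values `v t n` for
`t ∈ T'`, since `v t n` cannot be refuted by a condition with stem `t`. It remains to thin out `T`
so that at most `n + 1` values remain at each `n` (`IsLaverUltrafilter.exists_tree_slalom`). The
Laver ultrafilter is applied to the successors of each node separately. The node with code `e`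
contributes nothing new at `n < 2 ^ (e + 1)` and at most `n / 2 ^ (e + 1)` values at larger `n`;
together with the value at the stem these are at most `1 + ∑ e, n / 2 ^ (e + 1) ≤ n + 1` values.

*The Laver property gives a Laver ultrafilter.* Finite partitions are replaced by finite colourings
`c n` (`isLaverUltrafilter_iff_coloring`). Let `ℓ` be the generic real, and let `f(n)` code the
sequence of the `c n`-colours of `ℓ(0), …, ℓ(n - 1)`. If a condition with stem `w` forces `f` into
the slalom `S`, let `x` be the set of successors of `w`. For `n > |w|` and `a ∈ x`, the colour
`c n a` is the entry with index `|w|` of a sequence coded in `S n`, as `ℓ(|w|) = a` is possible. So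
`x` gets at most `n + 1` colours from `c n`. For the finitely many remaining `n`, shrink `x` to a
set in `U` on which `c n` is constant.
-/

/-! ### Forcing equality and membership -/

namespace PName

variable {P : Type u} [Preorder P]

theorem ForcesEq.mono {a b : PName P} {p q : P} (h : ForcesEq a b p) (hq : q ≤ p) :
    ForcesEq a b q := by
  cases a; cases b
  rw [ForcesEq] at h ⊢
  exact ⟨fun i r hr => h.1 i r (hr.trans hq), fun j r hr => h.2 j r (hr.trans hq)⟩

theorem ForcesMem.mono {a b : PName P} {p q : P} (h : ForcesMem a b p) (hq : q ≤ p) :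
    ForcesMem a b q := by
  cases b
  exact fun r hr => h r (hr.trans hq)

theorem ForcesMem.of_dense {a b : PName P} {p : P}
    (h : ∀ q ≤ p, ∃ r ≤ q, ForcesMem a b r) : ForcesMem a b p := by
  cases b
  intro q hq
  obtain ⟨r, hr, hrm⟩ := h q hq
  obtain ⟨r', hr', j, hj⟩ := hrm r le_rfl
  exact ⟨r', hr'.trans hr, j, hj⟩

theorem ForcesEq.refl (a : PName P) (p : P) : ForcesEq a a p := by
  induction a generalizing p with
  | mk ι x c ih =>
    rw [ForcesEq]
    exact ⟨fun i q _ hc => ⟨q, le_rfl, i, hc, ih i q⟩, fun i q _ hc => ⟨q, le_rfl, i, hc, ih i q⟩⟩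

variable [OrderTop P]

/-- Forced equality of canonical names is absolute. -/
theorem equiv_of_forcesEq_check {x y : PSet.{u}} {p : P} (h : ForcesEq (check x) (check y) p) :
    PSet.Equiv x y := by
  induction x generalizing y p with
  | mk ι x ih =>
    obtain ⟨κ, y⟩ := y
    rw [check, check, ForcesEq] at h
    refine ⟨fun i => ?_, fun j => ?_⟩
    · obtain ⟨r, -, j, -, hj⟩ := h.1 i p le_rfl le_top
      exact ⟨j, ih i hj⟩
    · obtain ⟨r, -, i, -, hi⟩ := h.2 j p le_rfl le_top
      exact ⟨i, ih i hi⟩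

end PName

namespace Forcing

theorem rank_ofNat (n : ℕ) : (PSet.ofNat.{u} n).rank = n := by
  induction n with
  | zero => exact PSet.rank_empty
  | succ n ih =>
    rw [PSet.ofNat, PSet.rank_insert, ih, max_eq_left (Order.le_succ _), Nat.cast_succ,
      Order.succ_eq_add_one]

theorem mk_ofNat_injective : Function.Injective fun n : ℕ => ZFSet.mk (PSet.ofNat.{u} n) := by
  intro n m h
  have h' := PSet.rank_congr (Quotient.exact h)
  simpa [rank_ofNat] using h'

theorem eq_of_natPair_equiv {n m n' m' : ℕ}
    (h : PSet.Equiv (natPair.{u} n m) (natPair.{u} n' m')) : n = n' ∧ m = m' := by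
  have h' : ZFSet.pair (ZFSet.mk (PSet.ofNat.{u} n)) (ZFSet.mk (PSet.ofNat m)) =
      ZFSet.pair (ZFSet.mk (PSet.ofNat n')) (ZFSet.mk (PSet.ofNat m')) := ZFSet.sound h
  obtain ⟨h₁, h₂⟩ := ZFSet.pair_injective h'
  exact ⟨mk_ofNat_injective h₁, mk_ofNat_injective h₂⟩

end Forcing

/-! ### Laver trees and their stems -/

/-- `T` is a tree with stem `s` all of whose nodes extending `s` have a set of successors in `U`.
For nonprincipal `U` the clause on comparability already makes `s` the longest node comparable with
all nodes of `T`, so no maximality is required. -/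
structure HasStem (U : Ultrafilter ℕ) (T : Set (List ℕ)) (s : List ℕ) : Prop where
  mem_of_prefix : ∀ {u v : List ℕ}, u <+: v → v ∈ T → u ∈ T
  stem_mem : s ∈ T
  comparable : ∀ {t}, t ∈ T → s <+: t ∨ t <+: s
  succ_mem : ∀ {t}, t ∈ T → s <+: t → succSet T t ∈ U

namespace HasStem

variable {U : Ultrafilter ℕ} {T T' : Set (List ℕ)} {s t : List ℕ}

theorem prefix_of_comparable (hU : ∀ n : ℕ, U ≠ pure n) (h : HasStem U T s)
    (ht : ∀ u ∈ T, t <+: u ∨ u <+: t) : t <+: s := by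
  rcases ht s h.stem_mem with hts | ⟨_ | ⟨a, l⟩, rfl⟩
  · exact hts
  · simp
  -- Otherwise all successors of `s` lie on the way to `t`, so `U` concentrates on one point.
  exfalso
  refine hU a (Ultrafilter.coe_injective ?_)
  refine (Filter.NeBot.le_pure_iff inferInstance).1 ?_
  rw [Filter.le_pure_iff]
  refine Filter.mem_of_superset (h.succ_mem h.stem_mem List.prefix_rfl) fun b hb => ?_
  rcases ht _ hb with h' | h'
  · have := (List.prefix_append_right_inj s).1 h'
    simp [List.cons_prefix_cons] at this
    simp [this]
  · have := (List.prefix_append_right_inj s).1 h'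
    simp [List.cons_prefix_cons] at this
    simp [this]

theorem isLaverTree (hU : ∀ n : ℕ, U ≠ pure n) (h : HasStem U T s) : IsLaverTree U T :=
  ⟨⟨⟨s, h.stem_mem⟩, fun _ _ => h.mem_of_prefix⟩, s,
    ⟨⟨h.stem_mem, fun _ => h.comparable⟩,
      fun _ _ ht => (h.prefix_of_comparable hU ht).length_le⟩, fun _ => h.succ_mem⟩

theorem inter (h : HasStem U T s) (h' : HasStem U T' s) : HasStem U (T ∩ T') s where
  mem_of_prefix huv hv := ⟨h.mem_of_prefix huv hv.1, h'.mem_of_prefix huv hv.2⟩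
  stem_mem := ⟨h.stem_mem, h'.stem_mem⟩
  comparable ht := h.comparable ht.1
  succ_mem ht hst := Filter.inter_mem (h.succ_mem ht.1 hst) (h'.succ_mem ht.2 hst)

/-- The nodes comparable with a node `t` beyond the stem form a tree with stem `t`. -/
theorem restrict (h : HasStem U T s) (ht : t ∈ T) (hst : s <+: t) :
    HasStem U {u ∈ T | t <+: u ∨ u <+: t} t where
  mem_of_prefix := by
    rintro u v huv ⟨hv, hv'⟩
    refine ⟨h.mem_of_prefix huv hv, ?_⟩
    rcases hv' with hv' | hv'
    · exact List.prefix_or_prefix_of_prefix hv' huv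
    · exact Or.inr (huv.trans hv')
  stem_mem := ⟨ht, Or.inl List.prefix_rfl⟩
  comparable hu := hu.2
  succ_mem := by
    rintro u ⟨hu, -⟩ htu
    exact Filter.mem_of_superset (h.succ_mem hu (hst.trans htu))
      fun a ha => ⟨ha, Or.inl (htu.trans (List.prefix_append _ _))⟩

theorem exists_mem_length (h : HasStem U T s) (n : ℕ) : ∃ t ∈ T, t.length = n := by
  suffices H : ∃ t ∈ T, s <+: t ∧ n ≤ t.length by
    obtain ⟨t, ht, -, hn⟩ := H
    exact ⟨t.take n, h.mem_of_prefix (List.take_prefix _ _) ht, by simpa using hn⟩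
  induction n with
  | zero => exact ⟨s, h.stem_mem, List.prefix_rfl, Nat.zero_le _⟩
  | succ n ih =>
    obtain ⟨t, ht, hst, hn⟩ := ih
    obtain ⟨a, ha⟩ := U.nonempty_of_mem (h.succ_mem ht hst)
    exact ⟨t ++ [a], ha, hst.trans (List.prefix_append _ _), by simpa using hn⟩

end HasStem

/-- The tree with stem `s` in which a node `u` extending `s` has the set of successors `X u`. -/
def treeOfSucc (s : List ℕ) (X : List ℕ → Set ℕ) : Set (List ℕ) :=
  {u | u <+: s ∨ s <+: u ∧ ∀ v a, s <+: v → v ++ [a] <+: u → a ∈ X v}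

section treeOfSucc

variable {s u : List ℕ} {X : List ℕ → Set ℕ}

theorem append_mem_treeOfSucc_iff {a : ℕ} (hsu : s <+: u) :
    u ++ [a] ∈ treeOfSucc s X ↔ u ∈ treeOfSucc s X ∧ a ∈ X u := by
  have hlen := hsu.length_le
  constructor
  · rintro (h | ⟨-, h⟩)
    · have := h.length_le
      simp at this
      omega
    · exact ⟨Or.inr ⟨hsu, fun v b hv hb => h v b hv (hb.trans (List.prefix_append _ _))⟩,
        h u a hsu List.prefix_rfl⟩
  · rintro ⟨hu, ha⟩
    refine Or.inr ⟨hsu.trans (List.prefix_append _ _), fun v b hv hb => ?_⟩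
    rcases List.prefix_concat_iff.1 hb with h | h
    · obtain ⟨rfl, h⟩ := List.append_inj' h rfl
      obtain rfl : b = a := by simpa using h
      exact ha
    · rcases hu with hu | hu
      · have := (h.trans hu).length_le
        have := hv.length_le
        simp at *
        omega
      · exact hu.2 v b hv h

theorem stem_mem_treeOfSucc : s ∈ treeOfSucc s X := Or.inl List.prefix_rfl

/-- Induction along the nodes of `treeOfSucc s X` that extend the stem. -/
theorem treeOfSucc_induction {p : List ℕ → Prop} (stem : p s)
    (succ : ∀ v a, v ∈ treeOfSucc s X → s <+: v → a ∈ X v → p v → p (v ++ [a]))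
    (hu : u ∈ treeOfSucc s X) (hsu : s <+: u) : p u := by
  induction u using List.reverseRecOn with
  | nil => rwa [← List.prefix_nil.1 hsu]
  | append_singleton v a ih =>
    rcases List.prefix_concat_iff.1 hsu with rfl | h
    · exact stem
    · obtain ⟨hv, ha⟩ := (append_mem_treeOfSucc_iff h).1 hu
      exact succ v a hv h ha (ih hv h)

theorem hasStem_treeOfSucc {U : Ultrafilter ℕ}
    (hX : ∀ u ∈ treeOfSucc s X, s <+: u → X u ∈ U) : HasStem U (treeOfSucc s X) s where
  mem_of_prefix := by
    rintro u v huv (hv | hv)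
    · exact Or.inl (huv.trans hv)
    · rcases List.prefix_or_prefix_of_prefix hv.1 huv with h | h
      · exact Or.inr ⟨h, fun w a hw ha => hv.2 w a hw (ha.trans huv)⟩
      · exact Or.inl h
  stem_mem := stem_mem_treeOfSucc
  comparable := by
    rintro t (ht | ht)
    · exact Or.inr ht
    · exact Or.inl ht.1
  succ_mem ht hst := Filter.mem_of_superset (hX _ ht hst)
    fun _ ha => (append_mem_treeOfSucc_iff hst).2 ⟨ht, ha⟩

theorem treeOfSucc_subset {U : Ultrafilter ℕ} {T : Set (List ℕ)} {r : List ℕ}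
    (hT : HasStem U T r) (hs : s ∈ T) (hX : ∀ u, X u ⊆ succSet T u) : treeOfSucc s X ⊆ T := by
  intro u hu
  rcases id hu with h | h
  · exact hT.mem_of_prefix h hs
  · exact treeOfSucc_induction (p := (· ∈ T)) hs (fun v a _ _ ha _ => hX v ha) hu h.1

end treeOfSucc

namespace LaverForcing

variable {U : Ultrafilter ℕ}

/-- The condition given by a tree with a stem. -/
def ofHasStem (hU : ∀ n : ℕ, U ≠ pure n) {T : Set (List ℕ)} {s : List ℕ} (h : HasStem U T s) :
    LaverForcing U := ⟨T, h.isLaverTree hU⟩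

theorem exists_hasStem (p : LaverForcing U) : ∃ s, HasStem U p.1 s := by
  obtain ⟨T, ⟨-, hT⟩, s, hs, hsucc⟩ := p
  exact ⟨s, fun huv hv => hT _ _ huv hv, hs.1.1, fun ht => hs.1.2 _ ht, fun ht => hsucc _ ht⟩

/-- Below every condition containing a node `t` there is one all of whose nodes are comparable with
`t`. -/
theorem exists_le_restrict (hU : ∀ n : ℕ, U ≠ pure n) (p : LaverForcing U) {t : List ℕ}
    (ht : t ∈ p.1) : ∃ q ≤ p, t ∈ q.1 ∧ ∀ u ∈ q.1, t <+: u ∨ u <+: t := by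
  obtain ⟨s, hs⟩ := p.exists_hasStem
  rcases hs.comparable ht with h | h
  · exact ⟨ofHasStem hU (hs.restrict ht h), fun u hu => hu.1, ⟨ht, Or.inl List.prefix_rfl⟩,
      fun u hu => hu.2⟩
  · refine ⟨p, le_rfl, ht, fun u hu => ?_⟩
    rcases hs.comparable hu with h' | h'
    · exact Or.inl (h.trans h')
    · exact List.prefix_or_prefix_of_prefix h h'

/-- Stems can only grow when conditions get stronger. -/
theorem stem_prefix (hU : ∀ n : ℕ, U ≠ pure n) {p q : LaverForcing U} (hpq : p ≤ q)
    {s t : List ℕ} (hq : HasStem U q.1 s) (hp : HasStem U p.1 t) : s <+: t :=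
  hp.prefix_of_comparable hU fun _ hu => hq.comparable (hpq hu)

end LaverForcing

/-! ### Pure decision -/

/-- Some condition contained in the tree `T` with stem `t` satisfies `φ`. -/
def PurelyForces (U : Ultrafilter ℕ) (T : Set (List ℕ)) (φ : LaverForcing U → Prop) (t : List ℕ) :
    Prop :=
  ∃ p : LaverForcing U, p.1 ⊆ T ∧ HasStem U p.1 t ∧ φ p

section PurelyForces

variable {U : Ultrafilter ℕ} {T : Set (List ℕ)} {φ ψ : LaverForcing U → Prop} {s t : List ℕ}

/-- Two conditions with the same stem are compatible. -/
theorem PurelyForces.exists_common (hU : ∀ n : ℕ, U ≠ pure n)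
    (hφ : ∀ p q, q ≤ p → φ p → φ q) (hψ : ∀ p q, q ≤ p → ψ p → ψ q)
    (h : PurelyForces U T φ t) (h' : PurelyForces U T ψ t) : ∃ p, φ p ∧ ψ p := by
  obtain ⟨p, -, hpt, hp⟩ := h
  obtain ⟨q, -, hqt, hq⟩ := h'
  exact ⟨.ofHasStem hU (hpt.inter hqt), hφ p _ Set.inter_subset_left hp,
    hψ q _ Set.inter_subset_right hq⟩

/-- Conditions purely forcing `φ` above `U`-many successors of `t` amalgamate to one with
stem `t`. -/
theorem PurelyForces.of_succ (hU : ∀ n : ℕ, U ≠ pure n) (hφ : ∀ p q, q ≤ p → φ p → φ q)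
    (hφd : ∀ p, (∀ q ≤ p, ∃ r ≤ q, φ r) → φ p)
    (h : {a | PurelyForces U T φ (t ++ [a])} ∈ U) : PurelyForces U T φ t := by
  set A := {a | PurelyForces U T φ (t ++ [a])}
  choose! p hpT hps hpφ using fun a (ha : a ∈ A) => ha
  obtain ⟨a₀, ha₀⟩ := U.nonempty_of_mem h
  have hstem : HasStem U (⋃ a ∈ A, (p a).1) t := by
    refine ⟨?_, ?_, ?_, ?_⟩
    · intro u v huv hv
      obtain ⟨a, ha, hv⟩ := Set.mem_iUnion₂.1 hv
      exact Set.mem_iUnion₂.2 ⟨a, ha, (hps a ha).mem_of_prefix huv hv⟩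
    · exact Set.mem_iUnion₂.2 ⟨a₀, ha₀,
        (hps a₀ ha₀).mem_of_prefix (List.prefix_append _ _) (hps a₀ ha₀).stem_mem⟩
    · intro u hu
      obtain ⟨a, ha, hu⟩ := Set.mem_iUnion₂.1 hu
      rcases (hps a ha).comparable hu with h | h
      · exact Or.inl ((List.prefix_append _ _).trans h)
      · exact List.prefix_or_prefix_of_prefix (List.prefix_append _ _) h
    · intro u hu htu
      obtain ⟨a, ha, hu⟩ := Set.mem_iUnion₂.1 hu
      have key : ∀ {v}, v ∈ (p a).1 → v ∈ ⋃ a ∈ A, (p a).1 :=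
        fun hv => Set.mem_iUnion₂.2 ⟨a, ha, hv⟩
      rcases (hps a ha).comparable hu with h' | h'
      · exact Filter.mem_of_superset ((hps a ha).succ_mem hu h') fun b hb => key hb
      rcases List.prefix_concat_iff.1 h' with rfl | h'
      · exact Filter.mem_of_superset ((hps a ha).succ_mem hu List.prefix_rfl) fun b hb => key hb
      · obtain rfl : u = t := h'.eq_of_length_le htu.length_le
        exact Filter.mem_of_superset h
          fun b hb => Set.mem_iUnion₂.2 ⟨b, hb, (hps b hb).stem_mem⟩
  refine ⟨.ofHasStem hU hstem, Set.iUnion₂_subset hpT, hstem, hφd _ fun q hq => ?_⟩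
  -- Every stronger condition contains some `t ++ [a]` with `a ∈ A`; restrict it to that node.
  have hqt : ∃ a ∈ A, t ++ [a] ∈ q.1 := by
    obtain ⟨w, hw⟩ := q.exists_hasStem
    obtain ⟨u, hu, hlen⟩ := hw.exists_mem_length (t.length + 1)
    obtain ⟨a, ha, hua⟩ := Set.mem_iUnion₂.1 (hq hu)
    refine ⟨a, ha, ?_⟩
    rcases (hps a ha).comparable hua with h' | h'
    · rwa [h'.eq_of_length (by simp [hlen])]
    · rwa [← h'.eq_of_length (by simp [hlen])]
  obtain ⟨a, ha, haq⟩ := hqt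
  obtain ⟨r, hrq, har, hr⟩ := q.exists_le_restrict hU haq
  refine ⟨r, hrq, hφ (p a) r (fun u hu => ?_) (hpφ a ha)⟩
  obtain ⟨b, hb, hub⟩ := Set.mem_iUnion₂.1 (hq (hrq hu))
  rcases hr u hu with h' | h'
  · suffices b = a by rwa [this] at hub
    rcases (hps b hb).comparable hub with h'' | h''
    · have := (List.prefix_of_prefix_length_le h'' h' (by simp)).eq_of_length (by simp)
      simpa using this
    · have := (h'.trans h'').eq_of_length (by simp)
      simpa using this.symm
  · exact (hps a ha).mem_of_prefix h' (hps a ha).stem_mem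

/-- Pure decision: if one of finitely many statements is forced to hold, then every node beyond the
stem of `T` purely forces one of them. If some node did not, then by amalgamation neither would
`U`-many of its successors, and so on: the undecided nodes would form a condition that no
stronger condition decides. -/
theorem exists_purelyForces (hU : ∀ n : ℕ, U ≠ pure n) (hT : HasStem U T s) (k : ℕ)
    (φ : ℕ → LaverForcing U → Prop) (hφ : ∀ m p q, q ≤ p → φ m p → φ m q)
    (hφd : ∀ m p, (∀ q ≤ p, ∃ r ≤ q, φ m r) → φ m p)
    (hk : ∀ q, ∃ r ≤ q, ∃ m < k, φ m r) (ht : t ∈ T) (hst : s <+: t) :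
    ∃ m < k, PurelyForces U T (φ m) t := by
  by_contra! hbad
  set X : List ℕ → Set ℕ :=
    fun u => {a | u ++ [a] ∈ T ∧ ∀ m < k, ¬ PurelyForces U T (φ m) (u ++ [a])}
  have hsub : treeOfSucc t X ⊆ T := treeOfSucc_subset hT ht fun u a ha => ha.1
  have hundec : ∀ u ∈ treeOfSucc t X, t <+: u → ∀ m < k, ¬ PurelyForces U T (φ m) u :=
    fun u hu htu => treeOfSucc_induction
      (p := fun u => ∀ m < k, ¬ PurelyForces U T (φ m) u) hbad (fun v a _ _ ha _ => ha.2) hu htu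
  have hX : ∀ u ∈ treeOfSucc t X, t <+: u → X u ∈ U := by
    intro u hu htu
    refine Filter.inter_mem (hT.succ_mem (hsub hu) (hst.trans htu)) ?_
    have : ∀ m ∈ Set.Iio k, {a | ¬ PurelyForces U T (φ m) (u ++ [a])} ∈ U := fun m hm =>
      Ultrafilter.compl_mem_iff_notMem.2 fun h =>
        hundec u hu htu m hm (.of_succ hU (hφ m) (hφd m) h)
    filter_upwards [(Filter.biInter_mem (Set.finite_Iio k)).2 this] with a ha
    exact fun m hm => Set.mem_iInter₂.1 ha m hm
  obtain ⟨r, hr, m, hm, hrm⟩ := hk (.ofHasStem hU (hasStem_treeOfSucc hX))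
  obtain ⟨w, hw⟩ := r.exists_hasStem
  exact hundec w (hr hw.stem_mem) (LaverForcing.stem_prefix hU hr (hasStem_treeOfSucc hX) hw) m hm
    ⟨r, fun u hu => hsub (hr hu), hw, hrm⟩

end PurelyForces

/-! ### Laver ultrafilters and colourings -/

/-- Being a Laver ultrafilter, with finite colourings of `ℕ` in place of finite partitions. -/
theorem isLaverUltrafilter_iff_coloring (U : Ultrafilter ℕ) :
    IsLaverUltrafilter U ↔ ∀ c : ℕ → ℕ → ℕ, (∀ n, (Set.range (c n)).Finite) →
      ∃ x ∈ U, ∀ n, (c n '' x).ncard ≤ n + 1 := by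
  classical
  constructor
  · intro h c hc
    let Q : ℕ → Finpartition (Set.univ : Set ℕ) := fun n =>
      { parts := (hc n).toFinset.image fun k => c n ⁻¹' {k}
        supIndep := by
          rw [Finset.supIndep_iff_pairwiseDisjoint]
          intro A hA B hB hAB
          simp only [Finset.coe_image, Set.mem_image] at hA hB
          obtain ⟨k, -, rfl⟩ := hA
          obtain ⟨l, -, rfl⟩ := hB
          refine Set.disjoint_left.2 fun a ha hb => hAB ?_
          rw [← show c n a = k from ha, ← show c n a = l from hb]
        sup_parts := by
          refine Set.eq_univ_of_forall fun a => ?_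
          simp
        bot_notMem := by
          intro hbot
          simp only [Finset.mem_image, Set.Finite.mem_toFinset] at hbot
          obtain ⟨_, ⟨a, rfl⟩, ha⟩ := hbot
          exact (ha ▸ (rfl : c n a = c n a) : a ∈ (⊥ : Set ℕ)) }
    obtain ⟨x, hx, hxn⟩ := h Q
    refine ⟨x, hx, fun n => le_trans ?_ (hxn n)⟩
    refine Set.ncard_le_ncard_of_injOn (fun k => c n ⁻¹' {k}) ?_ ?_
      ((Q n).parts.finite_toSet.subset fun A hA => hA.1)
    · rintro _ ⟨a, ha, rfl⟩
      exact ⟨Finset.mem_image_of_mem _ ((hc n).mem_toFinset.2 ⟨a, rfl⟩), a, ha, rfl⟩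
    · rintro _ ⟨a, ha, rfl⟩ k - hk
      exact (Set.ext_iff.1 hk a).1 rfl
  · intro h Q
    have hpart : ∀ n a, ∃ A ∈ (Q n).parts, a ∈ A := by
      intro n a
      have ha : a ∈ (Q n).parts.sup id := by rw [(Q n).sup_parts]; trivial
      simpa using ha
    choose A hA haA using hpart
    let e : ∀ n, (Q n).parts ≃ Fin (Q n).parts.card := fun n => (Q n).parts.equivFin
    obtain ⟨x, hx, hxn⟩ := h (fun n a => e n ⟨A n a, hA n a⟩) fun n =>
      (Set.finite_Iio (Q n).parts.card).subset (by rintro _ ⟨a, rfl⟩; exact Fin.is_lt _)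
    refine ⟨x, hx, fun n => le_trans ?_ (hxn n)⟩
    refine Set.ncard_le_ncard_of_injOn
      (fun B => if hB : B ∈ (Q n).parts then (e n ⟨B, hB⟩ : ℕ) else 0) ?_ ?_
      ((Set.finite_Iio (Q n).parts.card).subset (by rintro _ ⟨a, -, rfl⟩; exact Fin.is_lt _))
    · rintro B ⟨hB, a, hax, haB⟩
      have hAB : A n a = B := by
        by_contra hne
        exact Set.disjoint_left.1 ((Q n).disjoint (hA n a) hB hne) (haA n a) haB
      subst hAB
      exact ⟨a, hax, by simp [hB]⟩
    · rintro B ⟨hB, -⟩ B' ⟨hB', -⟩ h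
      simpa [hB, hB', Fin.val_inj] using h

theorem exists_mem_forall_eq_of_finite_range (U : Ultrafilter ℕ) {c : ℕ → ℕ}
    (hc : (Set.range c).Finite) : ∃ m, {a | c a = m} ∈ U := by
  obtain ⟨m, -, hm⟩ := (Ultrafilter.eventually_exists_mem_iff (f := U) (P := fun m a => c a = m)
    hc).1 (Filter.Eventually.of_forall fun a => ⟨c a, ⟨a, rfl⟩, rfl⟩)
  exact ⟨m, hm⟩

/-- A Laver ultrafilter contains a set on which the `n`-th colouring takes at most `n / K` values,
and is constant when `n < K`: colour with the first `(j + 2) * K` colours simultaneously. -/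
theorem IsLaverUltrafilter.exists_sparse {U : Ultrafilter ℕ} (hL : IsLaverUltrafilter U)
    {c : ℕ → ℕ → ℕ} (hc : ∀ n, (Set.range (c n)).Finite) {K : ℕ} (hK : 0 < K) :
    ∃ x ∈ U, (∀ n < K, ∀ a ∈ x, ∀ b ∈ x, c n a = c n b) ∧
      ∀ n, K ≤ n → (c n '' x).ncard ≤ n / K := by
  have hfin : ∀ j : ℕ,
      (Set.range fun a => (List.range ((j + 2) * K)).map fun n => c n a).Finite := by
    intro j
    generalize List.range ((j + 2) * K) = l
    induction l with
    | nil => exact (Set.finite_singleton []).subset (by rintro _ ⟨a, rfl⟩; simp)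
    | cons n l ih =>
      refine (Set.Finite.image2 List.cons (hc n) ih).subset ?_
      rintro _ ⟨a, rfl⟩
      exact ⟨_, ⟨a, rfl⟩, _, ⟨a, rfl⟩, rfl⟩
  let d : ℕ → ℕ → ℕ := fun j a =>
    Encodable.encode ((List.range ((j + 2) * K)).map fun n => c n a)
  have hd : ∀ j, (Set.range (d j)).Finite := fun j => by
    rw [show d j = Encodable.encode ∘ _ from rfl, Set.range_comp]
    exact (hfin j).image _
  -- The `j`-th joint colour determines the first `(j + 2) * K` colours.
  have hdc : ∀ {j n a b}, n < (j + 2) * K → d j a = d j b → c n a = c n b := by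
    intro j n a b hn h
    exact List.map_inj_left.1 (Encodable.encode_injective h) n (List.mem_range.2 hn)
  obtain ⟨x, hx, hxd⟩ := (isLaverUltrafilter_iff_coloring U).1 hL d hd
  refine ⟨x, hx, fun n hn a ha b hb => hdc (j := 0) (by omega) ?_, fun n hn => ?_⟩
  · exact Set.ncard_le_one_iff ((hd 0).subset (Set.image_subset_range _ _)) |>.1 (hxd 0)
      ⟨a, ha, rfl⟩ ⟨b, hb, rfl⟩
  · obtain ⟨j, hj⟩ : ∃ j, n / K = j + 1 :=
      Nat.exists_eq_add_one.2 (Nat.div_pos hn hK)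
    have hnj : n < (j + 2) * K := by
      have := Nat.lt_div_mul_add hK (a := n)
      rw [hj] at this
      linarith
    rw [hj]
    refine le_trans ?_ (hxd j)
    have hfin' := (hd j).subset (Set.image_subset_range _ x)
    refine le_trans (Set.ncard_le_ncard (t := (fun v => c n (Function.invFun (d j) v)) '' (d j '' x))
      ?_ (hfin'.image _)) (Set.ncard_image_le hfin')
    rintro _ ⟨a, ha, rfl⟩
    exact ⟨d j a, ⟨a, ha, rfl⟩, hdc hnj (Function.invFun_eq ⟨a, rfl⟩)⟩

/-! ### Laver ultrafilters give the Laver property -/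

/-- Let `v` assign to every node a function bounded by `g`, such that the function at `t` is the
pointwise `U`-limit of those at its successors. For a Laver ultrafilter, a tree can be thinned out,
keeping its stem, so that at most `n + 1` values are attained at `n`: the node with code `e` gets
successors of which at most `n / 2 ^ (e + 1)` many values arise at `n`, and only the old one if
`n < 2 ^ (e + 1)`. -/
theorem IsLaverUltrafilter.exists_tree_slalom {U : Ultrafilter ℕ} (hL : IsLaverUltrafilter U)
    {T : Set (List ℕ)} {s : List ℕ} (hT : HasStem U T s) {v : List ℕ → ℕ → ℕ} {g : ℕ → ℕ}
    (hvg : ∀ t n, v t n < g n)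
    (hlim : ∀ t ∈ T, s <+: t → ∀ n, {a | v (t ++ [a]) n = v t n} ∈ U) :
    ∃ T' ⊆ T, HasStem U T' s ∧ ∃ S : Forcing.Slalom g, ∀ t ∈ T', s <+: t → ∀ n, v t n ∈ S.1 n := by
  classical
  have hfin : ∀ t n, (Set.range fun a => v (t ++ [a]) n).Finite := fun t n =>
    (Set.finite_Iio (g n)).subset (by rintro _ ⟨a, rfl⟩; exact hvg _ _)
  choose Y hYU hYc hYn using fun t : List ℕ => hL.exists_sparse (hfin t)
    (K := 2 ^ (Encodable.encode t + 1)) (by positivity)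
  have hXT : ∀ u, Y u ∩ succSet T u ⊆ succSet T u := fun u => Set.inter_subset_right
  have hsub : treeOfSucc s (fun u => Y u ∩ succSet T u) ⊆ T :=
    treeOfSucc_subset hT hT.stem_mem hXT
  set T' := treeOfSucc s fun u => Y u ∩ succSet T u
  have hT' : HasStem U T' s := hasStem_treeOfSucc fun u hu hsu =>
    Filter.inter_mem (hYU u) (hT.succ_mem (hsub hu) hsu)
  let Z : ℕ → ℕ → Finset ℕ := fun n e =>
    let t := Denumerable.ofNat (List ℕ) e
    if 2 ^ (e + 1) ≤ n then ((hfin t n).subset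
      (Set.image_subset_range (fun a => v (t ++ [a]) n) (Y t))).toFinset else ∅
  have hZ : ∀ n e, (Z n e).card ≤ n / 2 ^ (e + 1) := by
    intro n e
    simp only [Z]
    split_ifs with h
    · rw [← Set.ncard_eq_toFinset_card _ _]
      have := hYn (Denumerable.ofNat (List ℕ) e) n
      rw [Denumerable.encode_ofNat] at this
      exact this h
    · simp
  let V : ℕ → Finset ℕ := fun n => insert (v s n) ((Finset.range n).biUnion (Z n))
  have hV : ∀ n, (V n).card ≤ n + 1 := by
    intro n
    refine (Finset.card_insert_le _ _).trans (Nat.add_le_add_right ?_ 1)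
    refine Finset.card_biUnion_le.trans ((Finset.sum_le_sum fun e _ => hZ n e).trans ?_)
    have h := Nat.geom_sum_Ico_le le_rfl n (n + 1)
    rw [Finset.sum_Ico_eq_sum_range] at h
    simpa [add_comm] using h
  refine ⟨T', hsub, hT', ⟨fun n => (V n).filter (· < g n), fun n => ⟨fun m hm => ?_, ?_⟩⟩, ?_⟩
  · simpa using (Finset.mem_filter.1 hm).2
  · exact (Finset.card_filter_le _ _).trans (hV n)
  intro t ht hst n
  refine Finset.mem_filter.2 ⟨?_, hvg t n⟩
  refine treeOfSucc_induction (p := fun t => v t n ∈ V n) (Finset.mem_insert_self _ _) ?_ ht hst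
  intro u a hu hsu ha hun
  by_cases hn : 2 ^ (Encodable.encode u + 1) ≤ n
  · refine Finset.mem_insert_of_mem (Finset.mem_biUnion.2 ⟨Encodable.encode u, ?_, ?_⟩)
    · have := Nat.lt_two_pow_self (n := Encodable.encode u + 1)
      simp
      omega
    · simp only [Z, Denumerable.ofNat_encode, if_pos hn, Set.Finite.mem_toFinset]
      exact ⟨a, ha.1, rfl⟩
  · -- The constant value on `Y u` is the limit `v u n`.
    obtain ⟨b, hb, hbY⟩ := U.nonempty_of_mem (Filter.inter_mem (hlim u (hsub hu) hsu n) (hYU u))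
    rw [show v (u ++ [a]) n = v (u ++ [b]) n from hYc u n (not_le.1 hn) a ha.1 b hbY,
      show v (u ++ [b]) n = v u n from hb]
    exact hun

open Forcing in
theorem laverProperty_of_isLaverUltrafilter {U : Ultrafilter ℕ} (hU : ∀ n : ℕ, U ≠ pure n)
    (hL : IsLaverUltrafilter U) : LaverProperty (LaverForcing U) := by
  intro f g hf hfg p₀ p hp₀
  clear hp₀
  obtain ⟨s, hs⟩ := p.exists_hasStem
  have hmono : ∀ n m (q r : LaverForcing U), r ≤ q → Value f n m q → Value f n m r :=
    fun n m q r hr h => PName.ForcesMem.mono h hr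
  have hdense : ∀ n m (q : LaverForcing U), (∀ r ≤ q, ∃ r' ≤ r, Value f n m r') → Value f n m q :=
    fun n m q h => PName.ForcesMem.of_dense h
  have hbdd : ∀ n (q : LaverForcing U), ∃ r ≤ q, ∃ m < g n, Value f n m r := fun n q => by
    obtain ⟨r, hr, m, hm⟩ := hfg q n q le_rfl
    exact ⟨r, hr, m.1, m.2, hm⟩
  have hex : ∀ t n, ∃ m < g n, t ∈ p.1 → s <+: t → PurelyForces U p.1 (Value f n m) t := by
    intro t n
    by_cases ht : t ∈ p.1 ∧ s <+: t
    · obtain ⟨m, hm, h⟩ := exists_purelyForces hU hs (g n) (Value f n) (hmono n) (hdense n)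
        (hbdd n) ht.1 ht.2
      exact ⟨m, hm, fun _ _ => h⟩
    · obtain ⟨-, -, m, hm, -⟩ := hbdd n p
      exact ⟨m, hm, fun h h' => absurd ⟨h, h'⟩ ht⟩
  choose v hvg hv using hex
  have huniq : ∀ t n m m', PurelyForces U p.1 (Value f n m) t →
      PurelyForces U p.1 (Value f n m') t → m = m' := by
    intro t n m m' h h'
    by_contra hne
    obtain ⟨q, hq⟩ := h.exists_common hU (hmono n m) (hmono n m') h'
    exact (hf q).2.2 n ⟨(m, m'), hne⟩ q le_rfl hq
  have hlim : ∀ t ∈ p.1, s <+: t → ∀ n, {a | v (t ++ [a]) n = v t n} ∈ U := by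
    intro t ht hst n
    obtain ⟨m, hm⟩ := exists_mem_forall_eq_of_finite_range U (c := fun a => v (t ++ [a]) n)
      ((Set.finite_Iio (g n)).subset (by rintro _ ⟨a, rfl⟩; exact hvg _ _))
    have hmt : PurelyForces U p.1 (Value f n m) t := by
      refine .of_succ hU (hmono n m) (hdense n m) ?_
      filter_upwards [hm, hs.succ_mem ht hst] with a ha hat
      have := hv (t ++ [a]) n hat (hst.trans (List.prefix_append _ _))
      rwa [ha] at this
    rwa [huniq t n _ _ (hv t n ht hst) hmt]
  obtain ⟨T', hT'p, hT', S, hS⟩ := hL.exists_tree_slalom hs hvg hlim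
  refine ⟨.ofHasStem hU hT', hT'p, S, fun n q hq => ?_⟩
  -- At the stem `w` of `q`, the value `v w n` is purely forced, hence compatible with `q`.
  obtain ⟨w, hw⟩ := q.exists_hasStem
  have hsw : s <+: w := LaverForcing.stem_prefix hU hq hT' hw
  have hwp : w ∈ p.1 := hT'p (hq hw.stem_mem)
  obtain ⟨r, -, hrw, hr⟩ := hv w n hwp hsw
  exact ⟨.ofHasStem hU (hw.inter hrw), Set.inter_subset_left,
    ⟨v w n, hS w (hq hw.stem_mem) hsw n⟩, hmono _ _ r _ Set.inter_subset_right hr⟩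

/-! ### The Laver property gives a Laver ultrafilter -/

section genericName

variable {U : Ultrafilter ℕ}

/-- The condition consisting of all finite sequences comparable with `s`. -/
def LaverForcing.cone (hU : ∀ n : ℕ, U ≠ pure n) (s : List ℕ) : LaverForcing U :=
  .ofHasStem (T := treeOfSucc s fun _ => Set.univ) hU
    (hasStem_treeOfSucc fun _ _ _ => Filter.univ_mem)

theorem LaverForcing.mem_cone {hU : ∀ n : ℕ, U ≠ pure n} {s t : List ℕ} :
    t ∈ (cone hU s).1 ↔ s <+: t ∨ t <+: s := by
  change (t <+: s ∨ s <+: t ∧ _) ↔ _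
  simp [or_comm]

/-- A name for the function that maps `n` to `F (ℓ ↾ n)`, where `ℓ` is the generic real, the union
of the stems of the conditions in the generic filter. -/
def genericName (hU : ∀ n : ℕ, U ≠ pure n) (F : List ℕ → ℕ) : PName (LaverForcing U) :=
  .mk (List ℕ) (fun s => PName.check (Forcing.natPair s.length (F s))) (LaverForcing.cone hU)

open Forcing LaverForcing

variable {hU : ∀ n : ℕ, U ≠ pure n} {F : List ℕ → ℕ}

/-- A condition forcing `n` to be mapped to `m` has an extension deciding `ℓ ↾ n` accordingly. -/
theorem exists_le_cone_of_value_genericName {n m : ℕ} {p : LaverForcing U}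
    (h : Value (genericName hU F) n m p) :
    ∃ q ≤ p, ∃ s : List ℕ, s.length = n ∧ F s = m ∧ q ≤ cone hU s := by
  obtain ⟨q, hq, s, hs, heq⟩ := h p le_rfl
  obtain ⟨rfl, rfl⟩ := eq_of_natPair_equiv (PName.equiv_of_forcesEq_check heq)
  exact ⟨q, hq, s, rfl, rfl, hs⟩

theorem value_genericName_of_le_cone {s : List ℕ} {p : LaverForcing U} (h : p ≤ cone hU s) :
    Value (genericName hU F) s.length (F s) p :=
  fun q hq => ⟨q, le_rfl, s, hq.trans h, PName.ForcesEq.refl _ _⟩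

theorem exists_le_cone_length (hU : ∀ n : ℕ, U ≠ pure n) (p : LaverForcing U) (n : ℕ) :
    ∃ q ≤ p, ∃ s : List ℕ, s.length = n ∧ q ≤ cone hU s := by
  obtain ⟨w, hw⟩ := p.exists_hasStem
  obtain ⟨s, hs, hn⟩ := hw.exists_mem_length n
  obtain ⟨q, hq, -, hqs⟩ := p.exists_le_restrict hU hs
  exact ⟨q, hq, s, hn, fun u hu => mem_cone.2 (hqs u hu)⟩

theorem prefix_of_le_cone {s t : List ℕ} {p : LaverForcing U} (hs : p ≤ cone hU s)
    (ht : p ≤ cone hU t) (hst : s.length ≤ t.length) : s <+: t := by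
  obtain ⟨w, hw⟩ := p.exists_hasStem
  obtain ⟨u, hu, hn⟩ := hw.exists_mem_length t.length
  have htu : t = u := by
    rcases mem_cone.1 (ht hu) with h | h
    · exact h.eq_of_length hn.symm
    · exact (h.eq_of_length hn).symm
  subst htu
  rcases mem_cone.1 (hs hu) with h | h
  · exact h
  · rw [h.eq_of_length_le hst]

theorem isReal_genericName : Forced (IsReal (genericName hU F)) := by
  refine fun p => ⟨fun x q _ ⟨hx, hneg⟩ => ?_, fun n q _ => ?_, fun n z q _ ⟨h₁, h₂⟩ => ?_⟩
  · obtain ⟨r, hr, s, -, heq⟩ := hx q le_rfl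
    exact hneg r hr fun r' hr' => ⟨r', le_rfl, ⟨(s.length, F s)⟩, le_top, heq.mono hr'⟩
  · obtain ⟨r, hr, s, rfl, hs⟩ := exists_le_cone_length hU q n
    exact ⟨r, hr, F s, value_genericName_of_le_cone hs⟩
  · obtain ⟨r, hr, s, hsn, hs, hrs⟩ := exists_le_cone_of_value_genericName h₁
    obtain ⟨r', hr', t, htn, ht, hrt⟩ :=
      exists_le_cone_of_value_genericName (PName.ForcesMem.mono h₂ hr)
    have hst : s = t := (prefix_of_le_cone (hr'.trans hrs) hrt (by omega)).eq_of_length (by omega)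
    exact z.2 (by rw [← hs, ← ht, hst])

theorem boundedBy_genericName {g : ℕ → ℕ} (hg : ∀ s, F s < g s.length) :
    Forced (BoundedBy (genericName hU F) g) := by
  intro p n q _
  obtain ⟨r, hr, s, rfl, hs⟩ := exists_le_cone_length hU q n
  exact ⟨r, hr, ⟨F s, hg s⟩, value_genericName_of_le_cone hs⟩

end genericName

theorem finite_setOf_map_of_length {c : ℕ → ℕ} (hc : (Set.range c).Finite) (n : ℕ) :
    {l : List ℕ | ∃ s : List ℕ, s.length = n ∧ s.map c = l}.Finite := by
  induction n with
  | zero =>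
    refine (Set.finite_singleton []).subset ?_
    rintro _ ⟨s, hs, rfl⟩
    simp [List.length_eq_zero_iff.1 hs]
  | succ n ih =>
    refine (Set.Finite.image2 List.cons hc ih).subset ?_
    rintro _ ⟨_ | ⟨a, s⟩, hs, rfl⟩
    · simp at hs
    · exact ⟨_, ⟨a, rfl⟩, _, ⟨s, by simpa using hs, rfl⟩, rfl⟩

open Forcing LaverForcing in
theorem isLaverUltrafilter_of_laverProperty {U : Ultrafilter ℕ} (hU : ∀ n : ℕ, U ≠ pure n)
    (hP : LaverProperty (LaverForcing U)) : IsLaverUltrafilter U := by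
  rw [isLaverUltrafilter_iff_coloring]
  intro c hc
  let F : List ℕ → ℕ := fun s => Encodable.encode (s.map (c s.length))
  have hg : ∀ n, ∃ N, ∀ s : List ℕ, s.length = n → F s < N := by
    intro n
    obtain ⟨N, hN⟩ := ((finite_setOf_map_of_length (hc n) n).image Encodable.encode).bddAbove
    refine ⟨N + 1, fun s hs => Nat.lt_succ_of_le (hN ⟨_, ⟨s, hs, rfl⟩, ?_⟩)⟩
    simp only [F, hs]
  choose g hg using hg
  obtain ⟨p, -, S, hS⟩ := hP (genericName hU F) g isReal_genericName
    (boundedBy_genericName fun s => hg _ s rfl) ⊤ ⊤ le_rfl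
  obtain ⟨w, hw⟩ := p.exists_hasStem
  -- The colourings with index at most `w.length` are made constant; on the successors of the stem
  -- `w` the other ones are controlled by `S`.
  choose m hm using fun n => exists_mem_forall_eq_of_finite_range U (hc n)
  refine ⟨succSet p.1 w ∩ ⋂ n ∈ Set.Iic w.length, {a | c n a = m n}, Filter.inter_mem
    (hw.succ_mem hw.stem_mem List.prefix_rfl)
    ((Filter.biInter_mem (Set.finite_Iic _)).2 fun n _ => hm n), fun n => ?_⟩
  rcases le_or_gt n w.length with hn | hn
  · refine (Set.ncard_le_ncard (t := {m n}) ?_).trans (by simp)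
    rintro _ ⟨a, ⟨-, ha⟩, rfl⟩
    exact Set.mem_iInter₂.1 ha n hn
  · refine le_trans ?_ (S.2 n).2
    -- The colour of a successor is read off from the code of a longer initial segment of `ℓ`.
    let dec : ℕ → ℕ := fun k =>
      ((Encodable.decode (α := List ℕ) k).getD []).getD w.length 0
    refine le_trans ?_ ((S.1 n).card_image_le (f := dec))
    rw [← Set.ncard_coe_finset]
    refine Set.ncard_le_ncard ?_ (Finset.finite_toSet _)
    rintro _ ⟨a, ⟨ha, -⟩, rfl⟩
    obtain ⟨q, hqp, -, hqa⟩ := p.exists_le_restrict hU (t := w ++ [a]) ha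
    obtain ⟨r, hrq, ⟨k, hk⟩, hrk⟩ := hS n q hqp
    obtain ⟨r', hr', s, hsn, rfl, hrs⟩ := exists_le_cone_of_value_genericName hrk
    have hpre : w ++ [a] <+: s := prefix_of_le_cone (hU := hU) (p := r')
      (fun u hu => mem_cone.2 (hqa u (hrq (hr' hu)))) hrs (by simp; omega)
    refine Finset.mem_coe.2 (Finset.mem_image.2 ⟨_, hk, ?_⟩)
    obtain ⟨l, rfl⟩ := hpre
    subst hsn
    simp [dec, F]

theorem mainTheorem1 (U : Ultrafilter ℕ) (hU : ∀ n : ℕ, U ≠ pure n) :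
    Forcing.LaverProperty (LaverForcing U) ↔ IsLaverUltrafilter U :=
  ⟨isLaverUltrafilter_of_laverProperty hU, laverProperty_of_isLaverUltrafilter hU⟩
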